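/- Let $\ell\ge 2$. A length-$\ell$ substitution $\theta$ on a finite nonempty alphabet $\mathcal A$ is an ordered collection of maps $\theta_0,\dots,\theta_{\ell-1}:\mathcal A\to\mathcal A$ (its columns). It acts on letters by $\theta(a)=\theta_0(a)\cdots\theta_{\ell-1}(a)$, and on finite words and on bi-infinite sequences by concatenation (with $\theta(u_0)$ starting at position $0$); ${\theta^n}_m$ ($0\le m<\ell^n$) are the columns of $\theta^n$. A word is allowed if it occurs in $\theta^k(a)$ for some $a\in\mathcal A$ and $k\in\mathbb N$, and $X_\theta\subset\mathcal A^{\mathbb Z}$ is the set of bi-infinite sequences all of whose finite subwords are allowed, with the product topology and the left shift $\sigma$. The substitution $\theta$ is primitive if for some $k$ every letter occurs in $\theta^k(a)$ for every $a$; aperiodic if $X_\theta$ contains no $\sigma$-periodic sequence; bijective if every $\theta_m$ is a bijection. The naïve column number of $\theta$ is $c=\min\{|{\theta^n}_m(\mathcal A)| : n\ge 0,\ 0\le m<\ell^n\}$, and $S_\theta$ is the semigroup of self-maps of $\mathcal A$ generated by $\theta_0,\dots,\theta_{\ell-1}$ under composition. For length-$\ell$ substitutions $\theta,\eta$, a factor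 map $F:X_\theta\to X_\eta$ is a continuous surjection with $F\circ\sigma=\sigma\circ F$; it preserves the fixed point fibre if $\theta(x)=x$ implies $\eta(F(x))=F(x)$ for $x\in X_\theta$; it has radius zero if there is a surjective map $\beta$ from the alphabet of $\theta$ to that of $\eta$ with $F(x)_n=\beta(x_n)$ for all $x\in X_\theta$ and $n\in\mathbb Z$. **Theorem.** Let $\theta$ be a primitive aperiodic length-$\ell$ substitution with naïve column number $c$, such that every $\theta$-periodic point of $X_\theta$ (i.e. every $x \in X_\theta$ with $\theta^k(x)=x$ for some $k\ge1$) is a fixed point of $\theta$. The following are equivalent: 1. there is a bijective length-$\ell$ substitution $\eta$ on an alphabet with $c$ letters and a factor map $F:X_\theta\to X_\eta$ which preserves the fixed point fibre; 2. $S_\theta$ has a unique minimal left ideal. Moreover, whenever $\eta$ is a bijective length-$\ell$ substitution on a finite alphabet, of any size, every factor map $F:X_\theta\to X_\eta$ which preserves the fixed point fibre has radius zero. -/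

import Mathlib

universe u v

/-- A length-`ℓ` substitution on the alphabet `A`: an ordered collection of `ℓ` column maps
`θ_0, …, θ_{ℓ-1} : A → A`. -/
structure ConstLengthSubst (A : Type*) (ℓ : ℕ) where
  /-- The column maps. -/
  col : Fin ℓ → A → A

namespace ConstLengthSubst

variable {A B : Type*} {ℓ : ℕ}

/-- The action on finite words by concatenation, where the letter `a` is sent to the word
`θ_0(a) ⋯ θ_{ℓ-1}(a)`. -/
def word (θ : ConstLengthSubst A ℓ) (w : List A) : List A :=
  w.flatMap fun a => List.ofFn fun m => θ.col m a

/-- A word is allowed if it appears in `θ^k(a)` for some letter `a` and some `k`. -/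
def Allowed (θ : ConstLengthSubst A ℓ) (w : List A) : Prop :=
  ∃ (a : A) (k : ℕ), w <:+: θ.word^[k] [a]

/-- The space `X_θ` of bi-infinite sequences all of whose finite subwords are allowed. -/
def X (θ : ConstLengthSubst A ℓ) : Set (ℤ → A) :=
  {x | ∀ (i : ℤ) (n : ℕ), θ.Allowed (List.ofFn fun j : Fin n => x (i + (j : ℕ)))}

/-- The left shift on bi-infinite sequences. -/
def shift (x : ℤ → A) : ℤ → A := fun n => x (n + 1)

theorem shift_mem_X (θ : ConstLengthSubst A ℓ) {x : ℤ → A} (hx : x ∈ θ.X) :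
    shift x ∈ θ.X := by
  intro i n
  have h := hx (i + 1) n
  have e : (fun j : Fin n => shift x (i + (j : ℕ))) = fun j : Fin n => x (i + 1 + (j : ℕ)) := by
    funext j
    simp only [shift]
    congr 1
    ring
  rw [e]
  exact h

/-- The left shift on `X_θ`. -/
def shiftX (θ : ConstLengthSubst A ℓ) (x : θ.X) : θ.X := ⟨shift x, θ.shift_mem_X x.2⟩

/-- The action on bi-infinite sequences: `θ(u)` is the concatenation of the words `θ(u_n)`, with
`θ(u_0)` starting at position `0`. -/
def seq [NeZero ℓ] (θ : ConstLengthSubst A ℓ) (u : ℤ → A) : ℤ → A := fun n =>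
  θ.col ⟨(n % (ℓ : ℤ)).toNat, by
    have h : (0 : ℤ) < (ℓ : ℤ) := by exact_mod_cast NeZero.pos ℓ
    have h1 := Int.emod_lt_of_pos n h
    have h2 := Int.emod_nonneg n h.ne'
    omega⟩ (u (n / (ℓ : ℤ)))

/-- The column maps of the powers: for `m < ℓ ^ n`, `θ.powCol n m` is the `m`-th column map of the
length-`ℓ ^ n` substitution `θ^n`, that is, `a ↦` the letter at position `m` of `θ^n(a)`; see
`iterate_word_singleton`. -/
def powCol [NeZero ℓ] (θ : ConstLengthSubst A ℓ) : ℕ → ℕ → A → A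
  | 0, _ => id
  | n + 1, m => θ.col ⟨m % ℓ, Nat.mod_lt m (NeZero.pos ℓ)⟩ ∘ θ.powCol n (m / ℓ)

theorem iterate_word_singleton [NeZero ℓ] (θ : ConstLengthSubst A ℓ) (n : ℕ) (a : A) :
    θ.word^[n] [a] = List.ofFn fun m : Fin (ℓ ^ n) => θ.powCol n m a := by
  induction n with
  | zero => simp [powCol]
  | succ n ih =>
    rw [Function.iterate_succ_apply', ih, word]
    rw [List.ofFn_congr (pow_succ ℓ n), List.ofFn_mul]
    rw [List.flatMap, List.map_ofFn]
    congr 2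
    funext i
    simp only [Function.comp_apply]
    congr 1
    funext j
    have hℓ : 0 < ℓ := NeZero.pos ℓ
    have h1 : ((i : ℕ) * ℓ + (j : ℕ)) / ℓ = i := by
      rw [Nat.add_comm, Nat.add_mul_div_right _ _ hℓ, Nat.div_eq_of_lt j.2, Nat.zero_add]
    have h2 : ((i : ℕ) * ℓ + (j : ℕ)) % ℓ = j := by
      rw [Nat.add_comm, Nat.add_mul_mod_self_right, Nat.mod_eq_of_lt j.2]
    simp [powCol, h1, h2]

/-- The naïve column number: the minimal number of letters in the image of a column map of some
power of `θ`. -/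
noncomputable def columnNumber [NeZero ℓ] (θ : ConstLengthSubst A ℓ) : ℕ :=
  sInf {r : ℕ | ∃ n m : ℕ, m < ℓ ^ n ∧ r = (Set.range (θ.powCol n m)).ncard}

/-- Primitivity: for some `k`, every letter occurs in every word `θ^k(a)`. -/
def IsPrimitive (θ : ConstLengthSubst A ℓ) : Prop :=
  ∃ k : ℕ, ∀ a a' : A, a' ∈ θ.word^[k] [a]

/-- Aperiodicity: `X_θ` contains no shift-periodic sequence. -/
def IsAperiodic (θ : ConstLengthSubst A ℓ) : Prop :=
  ∀ x ∈ θ.X, x ∉ Function.periodicPts (shift : (ℤ → A) → ℤ → A)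

/-- Bijectivity: all column maps are bijections. -/
def IsBijective (θ : ConstLengthSubst A ℓ) : Prop :=
  ∀ m : Fin ℓ, Function.Bijective (θ.col m)

/-- The semigroup `S_θ` of self-maps of `A` (under composition) generated by the column maps. -/
def semigroup (θ : ConstLengthSubst A ℓ) : Subsemigroup (Function.End A) :=
  Subsemigroup.closure {f : Function.End A | ∃ m : Fin ℓ, f = θ.col m}

/-- A factor map `X_θ → X_η`: a continuous surjection commuting with the shifts. The alphabets
are discrete, sequence spaces have the product topology, and shifts the subspace topology. -/
def IsFactorMap (θ : ConstLengthSubst A ℓ) (η : ConstLengthSubst B ℓ) (F : θ.X → η.X) : Prop :=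
  letI : TopologicalSpace A := ⊥
  letI : TopologicalSpace B := ⊥
  Continuous F ∧ Function.Surjective F ∧ Function.Semiconj F θ.shiftX η.shiftX

/-- `F : X_θ → X_η` preserves the fixed point fibre if it sends `θ`-fixed points to `η`-fixed
points. -/
def PreservesFixedPointFibre [NeZero ℓ] (θ : ConstLengthSubst A ℓ) (η : ConstLengthSubst B ℓ)
    (F : θ.X → η.X) : Prop :=
  ∀ x : θ.X, Function.IsFixedPt θ.seq (x : ℤ → A) → Function.IsFixedPt η.seq (F x : ℤ → B)

/-- `F : X_θ → X_η` has radius zero: it is given by a surjective letter-to-letter code. -/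
def HasRadiusZero (θ : ConstLengthSubst A ℓ) (η : ConstLengthSubst B ℓ) (F : θ.X → η.X) : Prop :=
  ∃ β : A → B, Function.Surjective β ∧
    ∀ (x : θ.X) (n : ℤ), (F x : ℤ → B) n = β ((x : ℤ → A) n)

end ConstLengthSubst

/-- A left ideal of a semigroup `S`: a nonempty subset `I` with `S I ⊆ I`. -/
def IsSemigroupLeftIdeal {S : Type*} [Semigroup S] (I : Set S) : Prop :=
  I.Nonempty ∧ ∀ s : S, ∀ x ∈ I, s * x ∈ I

/-- `S` has a unique minimal left ideal (minimal with respect to inclusion). -/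
def HasUniqueMinimalLeftIdeal (S : Type*) [Semigroup S] : Prop :=
  ∃! I : Set S, Minimal IsSemigroupLeftIdeal I

/-! ### Minimal left ideals and fibres of minimal-rank maps. -/

section LeftIdeals

/-! Periodic points exist by pigeonhole, so by assumption `θ` has a fixed point `x`. Let `F` have a
local rule of radius `r`. Equal letters of `x` grow under a power of `θ` into equal blocks longer
than a window, so `F x` takes equal values well inside these blocks. Those values are images of the
original letters of `F x` under one column of a power of `η`, which is injective; hence `F x n`
depends only on `x n`. By primitivity every window of the subshift occurs in `x`, so `F` is a letter
code `β` (`IsPrimitive.hasRadiusZero`).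

Comparing the two fixed points, `β` intertwines the columns. If `η` is bijective on `c` letters, `β`
is then injective on the image of each rank-`c` element of the semigroup, so all these elements have
the fibres of `β`. Conversely, if they share their fibres, each column permutes the fibres and acts
on the quotient as a bijective substitution. Sharing fibres is equivalent to having one minimal left
ideal (`hasUniqueMinimalLeftIdeal_iff`). -/

theorem eq_iff_of_ncard_range_le {A B C : Type*} [Finite A] {f : A → B} {g : B → C}
    (h : (Set.range f).ncard ≤ (Set.range (g ∘ f)).ncard) (a b : A) :
    g (f a) = g (f b) ↔ f a = f b := by
  refine ⟨fun e => ?_, fun e => by rw [e]⟩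
  have hle := Set.ncard_image_le (f := g) (Set.toFinite (Set.range f))
  rw [Set.range_comp] at h
  exact Set.injOn_of_ncard_image_eq (le_antisymm hle h) (Set.toFinite _) ⟨a, rfl⟩ ⟨b, rfl⟩ e

/-- A semigroup of self-maps of a finite set has a unique minimal left ideal if and only if all its
elements of minimal rank have the same fibres. -/
theorem hasUniqueMinimalLeftIdeal_iff {A : Type*} [Finite A] (S : Subsemigroup (Function.End A))
    {c : ℕ} (hle : ∀ f ∈ S, c ≤ (Set.range (f : A → A)).ncard)
    (hex : ∃ f ∈ S, (Set.range (f : A → A)).ncard = c) :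
    HasUniqueMinimalLeftIdeal S ↔ ∀ f ∈ S, ∀ g ∈ S,
      (Set.range (f : A → A)).ncard = c → (Set.range (g : A → A)).ncard = c →
        ∀ a b : A, f a = f b → g a = g b := by
  have : Finite (Function.End A) := inferInstanceAs (Finite (A → A))
  have hfin : Finite S := Finite.of_injective (fun s : S => ((s : Function.End A) : A → A))
    fun s t h => Subtype.ext h
  constructor
  · rintro ⟨I, -, huniq⟩
    have key : ∀ f : S, (Set.range ((f : Function.End A) : A → A)).ncard = c →
        ∀ x ∈ I, ∀ a b : A, (x : Function.End A) a = (x : Function.End A) b ↔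
          (f : Function.End A) a = (f : Function.End A) b := by
      intro f hf x hx a b
      -- The left ideal `S f` contains a minimal one, which must be `I`. So `x = s * f`, and
      -- minimality of the rank of `f` forces equal fibres.
      obtain ⟨M, hM, hmin⟩ := Set.Finite.exists_le_minimal
        (Set.toFinite {J : Set S | IsSemigroupLeftIdeal J}) (a := {y | ∃ s : S, y = s * f})
        ⟨⟨f * f, f, rfl⟩, by
          rintro s _ ⟨t, rfl⟩
          exact ⟨s * t, (mul_assoc _ _ _).symm⟩⟩
      obtain rfl := huniq M hmin
      obtain ⟨s, rfl⟩ := hM hx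
      exact eq_iff_of_ncard_range_le (hf.le.trans (hle _ (s * f).2)) a b
    have hIne : I.Nonempty := by
      obtain ⟨f, hf, -⟩ := hex
      obtain ⟨M, -, hmin⟩ := Set.Finite.exists_le_minimal
        (Set.toFinite {J : Set S | IsSemigroupLeftIdeal J}) (a := Set.univ)
        ⟨⟨⟨f, hf⟩, trivial⟩, fun _ _ _ => trivial⟩
      obtain rfl := huniq M hmin
      exact hmin.1.1
    obtain ⟨x, hx⟩ := hIne
    intro f hf g hg hfc hgc a b hab
    exact (key ⟨g, hg⟩ hgc x hx a b).1 ((key ⟨f, hf⟩ hfc x hx a b).2 hab)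
  · intro hker
    set I : Set S := {x | (Set.range ((x : Function.End A) : A → A)).ncard = c} with hI
    have hmul : ∀ s : S, ∀ x ∈ I, s * x ∈ I := by
      intro s x hx
      refine le_antisymm ?_ (hle _ (s * x).2)
      rw [← show _ = c from hx]
      have : Set.range (((s * x : S) : Function.End A) : A → A)
          = ((s : Function.End A) : A → A) '' Set.range ((x : Function.End A) : A → A) :=
        Set.range_comp (s : Function.End A) (x : Function.End A)
      rw [this]
      exact Set.ncard_image_le (Set.toFinite _)
    have hmul' : ∀ s : S, ∀ x ∈ I, x * s ∈ I := by
      intro s x hx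
      refine le_antisymm ?_ (hle _ (x * s).2)
      rw [← show _ = c from hx]
      exact Set.ncard_le_ncard (Set.range_comp_subset_range (s : Function.End A) (x : Function.End A)) (Set.toFinite _)
    have hleft : IsSemigroupLeftIdeal I := by
      obtain ⟨f, hf, hfc⟩ := hex
      exact ⟨⟨⟨f, hf⟩, hfc⟩, hmul⟩
    have hleast : ∀ J : Set S, IsSemigroupLeftIdeal J → I ⊆ J := by
      intro J hJ x hx
      let : TopologicalSpace S := ⊥
      have : DiscreteTopology S := ⟨rfl⟩
      obtain ⟨y, hy⟩ := hJ.1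
      -- An idempotent `e` of `I ∩ J` is a right identity on `I`: `e (e a) = e a`, and `x` has the
      -- fibres of `e`, so `x (e a) = x a`. Thus `I` lies in every left ideal.
      obtain ⟨e, ⟨heI, heJ⟩, hee⟩ := exists_idempotent_in_compact_subsemigroup
        (fun _ => continuous_of_discreteTopology) (I ∩ J)
        ⟨x * y, hmul' _ _ hx, hJ.2 _ _ hy⟩ (Set.toFinite _).isCompact
        (fun u _ v hv => ⟨hmul _ _ hv.1, hJ.2 _ _ hv.2⟩)
      have : x * e = x := by
        apply Subtype.ext
        funext a
        exact hker e e.2 x x.2 heI hx _ _ (congrFun (congrArg Subtype.val hee) a)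
      rw [← this]
      exact hJ.2 _ _ heJ
    refine ⟨I, ⟨hleft, fun J hJ _ => hleast J hJ⟩, fun J hJ => ?_⟩
    exact le_antisymm (hJ.2 hleft (hleast J hJ.1)) (hleast J hJ.1)

end LeftIdeals

/-! ### Columns of powers, and points of the subshift. -/

namespace ConstLengthSubst

variable {A B : Type*} {ℓ : ℕ}

theorem index_lt {n k m i : ℕ} (hm : m < ℓ ^ n) (hi : i < ℓ ^ k) :
    m * ℓ ^ k + i < ℓ ^ (n + k) := by
  calc m * ℓ ^ k + i < m * ℓ ^ k + ℓ ^ k := by omega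
    _ = (m + 1) * ℓ ^ k := by ring
    _ ≤ ℓ ^ n * ℓ ^ k := Nat.mul_le_mul_right _ hm
    _ = ℓ ^ (n + k) := (pow_add _ _ _).symm

section Columns

variable [NeZero ℓ]

theorem powCol_add (θ : ConstLengthSubst A ℓ) (n k m i : ℕ) (hi : i < ℓ ^ k) (a : A) :
    θ.powCol (n + k) (m * ℓ ^ k + i) a = θ.powCol k i (θ.powCol n m a) := by
  induction k generalizing i with
  | zero =>
    obtain rfl : i = 0 := by simpa using hi
    simp [powCol]
  | succ k ih =>
    have hℓ : 0 < ℓ := NeZero.pos ℓ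
    have h1 : (m * ℓ ^ (k + 1) + i) / ℓ = m * ℓ ^ k + i / ℓ := by
      rw [pow_succ, ← mul_assoc, add_comm, Nat.add_mul_div_right _ _ hℓ, add_comm]
    have h2 : (m * ℓ ^ (k + 1) + i) % ℓ = i % ℓ := by
      rw [pow_succ, ← mul_assoc, add_comm, Nat.add_mul_mod_self_right]
    have h3 : i / ℓ < ℓ ^ k := by
      rw [Nat.div_lt_iff_lt_mul hℓ, ← pow_succ]; exact hi
    change θ.powCol ((n + k) + 1) _ a = _
    rw [powCol, powCol]
    simp only [Function.comp_apply, h1, h2, ih _ h3]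

theorem powCol_one (θ : ConstLengthSubst A ℓ) (m : Fin ℓ) : θ.powCol 1 m = θ.col m := by
  funext a
  simp [powCol, Nat.mod_eq_of_lt m.2]

theorem seq_iterate_apply (θ : ConstLengthSubst A ℓ) (x : ℤ → A) (k m : ℕ) (hm : m < ℓ ^ k)
    (n : ℤ) : θ.seq^[k] x (n * (ℓ : ℤ) ^ k + m) = θ.powCol k m (x n) := by
  induction k generalizing m with
  | zero =>
    obtain rfl : m = 0 := by simpa using hm
    simp [powCol]
  | succ k ih =>
    have hℓ : 0 < ℓ := NeZero.pos ℓ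
    have hℓ' : (ℓ : ℤ) ≠ 0 := by exact_mod_cast hℓ.ne'
    have h1 : (n * (ℓ : ℤ) ^ (k + 1) + m) / ℓ = n * (ℓ : ℤ) ^ k + (m / ℓ : ℕ) := by
      rw [pow_succ, ← mul_assoc, add_comm, Int.add_mul_ediv_right _ _ hℓ', add_comm]
      simp
    have h2 : (n * (ℓ : ℤ) ^ (k + 1) + m) % ℓ = (m % ℓ : ℕ) := by
      rw [pow_succ, ← mul_assoc, add_comm, Int.add_mul_emod_self_right]
      simp
    have h3 : m / ℓ < ℓ ^ k := by
      rw [Nat.div_lt_iff_lt_mul hℓ, ← pow_succ]; exact hm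
    rw [Function.iterate_succ_apply']
    simp only [seq, powCol, Function.comp_apply, h1, h2, ih _ h3, Int.toNat_natCast]

theorem seq_iterate_apply' (θ : ConstLengthSubst A ℓ) (x : ℤ → A) (k : ℕ) (i : ℤ) :
    θ.seq^[k] x i = θ.powCol k (i % (ℓ : ℤ) ^ k).toNat (x (i / (ℓ : ℤ) ^ k)) := by
  have hℓ : (0 : ℤ) < (ℓ : ℤ) ^ k := pow_pos (by exact_mod_cast NeZero.pos ℓ) k
  have h0 := Int.emod_nonneg i hℓ.ne'
  have h1 := Int.emod_lt_of_pos i hℓ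
  rw [← θ.seq_iterate_apply x k _ (by zify; rwa [Int.toNat_of_nonneg h0]),
    Int.toNat_of_nonneg h0, Int.ediv_mul_add_emod]

theorem isFixedPt_apply {θ : ConstLengthSubst A ℓ} {x : ℤ → A}
    (hx : Function.IsFixedPt θ.seq x) (k m : ℕ) (hm : m < ℓ ^ k) (n : ℤ) :
    x (n * (ℓ : ℤ) ^ k + m) = θ.powCol k m (x n) := by
  rw [← θ.seq_iterate_apply x k m hm, (hx.iterate k).eq]

theorem allowed_ofFn_iff (θ : ConstLengthSubst A ℓ) {n : ℕ} (w : Fin n → A) :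
    θ.Allowed (List.ofFn w) ↔ ∃ (a : A) (k i : ℕ), i + n ≤ ℓ ^ k ∧
      ∀ j : Fin n, w j = θ.powCol k (i + j) a := by
  simp only [Allowed, iterate_word_singleton, List.infix_iff_getElem?, List.length_ofFn]
  refine exists_congr fun a => exists_congr fun k => exists_congr fun i => ?_
  rw [add_comm n i]
  refine and_congr_right fun h => ⟨fun H j => ?_, fun H j hj => ?_⟩
  · have := H j j.2
    rw [List.getElem?_eq_getElem (by simp; omega)] at this
    simp only [List.getElem_ofFn, Option.some.injEq] at this
    rw [← this, add_comm]
  · rw [List.getElem?_eq_getElem (by simp; omega)]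
    simp only [List.getElem_ofFn, Option.some.injEq]
    rw [H ⟨j, hj⟩, add_comm]

theorem mem_X_iff (θ : ConstLengthSubst A ℓ) {x : ℤ → A} :
    x ∈ θ.X ↔ ∀ (s : ℤ) (n : ℕ), ∃ (a : A) (k i : ℕ), i + n ≤ ℓ ^ k ∧
      ∀ j < n, x (s + (j : ℕ)) = θ.powCol k (i + j) a := by
  simp only [X, Set.mem_ofPred_eq, allowed_ofFn_iff, Fin.forall_iff]

theorem mem_X_of_windows (θ : ConstLengthSubst A ℓ) {x : ℤ → A}
    (h : ∀ N : ℕ, ∃ z ∈ θ.X, ∀ i : ℤ, i.natAbs ≤ N → x i = z i) : x ∈ θ.X := by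
  refine θ.mem_X_iff.2 fun s n => ?_
  obtain ⟨z, hz, hxz⟩ := h (s.natAbs + n)
  obtain ⟨a, k, i, hi, hw⟩ := θ.mem_X_iff.1 hz s n
  exact ⟨a, k, i, hi, fun j hj => (hxz _ (by omega)).trans (hw j hj)⟩

theorem translate_mem_X (θ : ConstLengthSubst A ℓ) {x : ℤ → A} (hx : x ∈ θ.X) (t : ℤ) :
    (fun i => x (i + t)) ∈ θ.X := by
  refine θ.mem_X_iff.2 fun s n => ?_
  obtain ⟨a, k, i, hi, hw⟩ := θ.mem_X_iff.1 hx (s + t) n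
  exact ⟨a, k, i, hi, fun j hj => by rw [← hw j hj]; congr 1; ring⟩

theorem seq_mem_X (θ : ConstLengthSubst A ℓ) {x : ℤ → A} (hx : x ∈ θ.X) : θ.seq x ∈ θ.X := by
  refine θ.mem_X_iff.2 fun s n => ?_
  have hℓ : 0 < ℓ := NeZero.pos ℓ
  have hℓ' : (0 : ℤ) < ℓ := by exact_mod_cast hℓ
  obtain ⟨r, hr⟩ := Int.eq_ofNat_of_zero_le (Int.emod_nonneg s hℓ'.ne')
  have hs : s = s / ℓ * ℓ + r := by rw [← hr, Int.ediv_mul_add_emod]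
  -- A window of `r + n` letters is longer than needed, but surely covers the preimages of the `n`
  -- letters starting at offset `r`.
  obtain ⟨a, k, i, hi, hw⟩ := θ.mem_X_iff.1 hx (s / ℓ) (r + n)
  refine ⟨a, k + 1, i * ℓ + r, ?_, fun j hj => ?_⟩
  · calc i * ℓ + r + n ≤ i * ℓ + (r + n) * ℓ := by nlinarith
      _ = (i + (r + n)) * ℓ := by ring
      _ ≤ ℓ ^ k * ℓ := Nat.mul_le_mul_right _ hi
      _ = ℓ ^ (k + 1) := (pow_succ _ _).symm
  · have e : s + (j : ℤ) = (s / ℓ + ((r + j) / ℓ : ℕ)) * (ℓ : ℤ) ^ 1 + ((r + j) % ℓ : ℕ) := by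
      have := Nat.div_add_mod (r + j) ℓ
      zify at this ⊢
      linear_combination hs - this
    have e2 : i * ℓ + r + j = (i + (r + j) / ℓ) * ℓ ^ 1 + (r + j) % ℓ := by
      have := Nat.div_add_mod (r + j) ℓ
      linarith
    have hlt : (r + j) % ℓ < ℓ ^ 1 := by simpa using Nat.mod_lt _ hℓ
    have hdiv : (r + j) / ℓ < r + n := (Nat.div_le_self _ _).trans_lt (by omega)
    have := θ.seq_iterate_apply x 1 _ hlt (s / ℓ + ((r + j) / ℓ : ℕ))
    rw [Function.iterate_one] at this
    rw [e, this, e2, powCol_add _ _ _ _ _ hlt, hw _ hdiv]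

theorem seq_iterate_mem_X (θ : ConstLengthSubst A ℓ) {x : ℤ → A} (hx : x ∈ θ.X) (k : ℕ) :
    θ.seq^[k] x ∈ θ.X := by
  induction k with
  | zero => exact hx
  | succ k ih => rw [Function.iterate_succ_apply']; exact θ.seq_mem_X ih

/-- A letter that recurs strictly inside one of its own iterated images occurs in the subshift. -/
theorem exists_mem_X_of_interior (θ : ConstLengthSubst A ℓ) (hℓ : 2 ≤ ℓ) {a : A} {p m : ℕ}
    (hm : 0 < m) (hmp : m + 1 < ℓ ^ p) (ha : θ.powCol p m a = a) : ∃ x ∈ θ.X, x 0 = a := by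
  -- `M k` is the position of the central `a` in the `k`-fold nesting of the words `θ^(p j)(a)`.
  -- Since `m` is interior, both margins around it grow without bound, and the recentred words `y k`
  -- converge.
  set M : ℕ → ℕ := fun k => ∑ j ∈ Finset.range k, m * ℓ ^ (p * j) with hM
  have hMs : ∀ k, M (k + 1) = m * ℓ ^ (p * k) + M k := fun k => by
    simp only [hM, Finset.sum_range_succ, add_comm]
  have hp : 0 < p := by
    rcases Nat.eq_zero_or_pos p with rfl | h
    · simp at hmp
    · exact h
  have hpow : ∀ k, ℓ ^ (p * (k + 1)) = ℓ ^ p * ℓ ^ (p * k) := fun k => by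
    rw [mul_add, mul_one, pow_add, mul_comm]
  have hbig : ∀ k, k < ℓ ^ (p * k) := fun k =>
    (Nat.le_mul_of_pos_left k hp).trans_lt (Nat.lt_pow_self hℓ)
  have hMlt : ∀ k, M k < ℓ ^ (p * k) := by
    intro k
    induction k with
    | zero => simp [hM]
    | succ k ih =>
      rw [hMs, hpow]
      nlinarith
  have hlow : ∀ k, k < M (k + 1) := fun k => by
    rw [hMs]
    nlinarith [hbig k]
  have hhigh : ∀ k, M (k + 1) + k < ℓ ^ (p * (k + 1)) := fun k => by
    rw [hMs, hpow]
    nlinarith [hbig k, hMlt k]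
  have hstep : ∀ k i, i < ℓ ^ (p * k) →
      θ.powCol (p * (k + 1)) (m * ℓ ^ (p * k) + i) a = θ.powCol (p * k) i a := fun k i hi => by
    rw [mul_add, mul_one, add_comm (p * k) p, powCol_add _ _ _ _ _ hi, ha]
  set y : ℕ → ℤ → A := fun k i => θ.powCol (p * (k + 1)) ((M (k + 1) : ℤ) + i).toNat a with hy
  have hyy : ∀ N d (i : ℤ), i.natAbs ≤ N → y (N + d) i = y N i := by
    intro N d i hi
    induction d with
    | zero => rfl
    | succ d ih =>
      rw [← ih, ← add_assoc]
      simp only [hy]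
      have h1 := hlow (N + d)
      have h2 := hhigh (N + d)
      have e : ((M (N + d + 1 + 1) : ℤ) + i).toNat
          = m * ℓ ^ (p * (N + d + 1)) + ((M (N + d + 1) : ℤ) + i).toNat := by
        rw [hMs (N + d + 1)]
        generalize m * ℓ ^ (p * (N + d + 1)) = t
        omega
      rw [e, hstep _ _ (by omega)]
  refine ⟨fun i => y i.natAbs i, θ.mem_X_iff.2 fun s n => ?_, ?_⟩
  · set N := s.natAbs + n with hN
    have h1 := hlow N
    have h2 := hhigh N
    refine ⟨a, p * (N + 1), ((M (N + 1) : ℤ) + s).toNat, by omega, fun j hj => ?_⟩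
    obtain ⟨d, hd⟩ := Nat.exists_eq_add_of_le (show (s + (j : ℤ)).natAbs ≤ N by omega)
    have := hyy _ d (s + (j : ℤ)) le_rfl
    rw [← hd] at this
    rw [← this]
    simp only [hy]
    congr 1
    omega
  · simp only [hy, Int.natAbs_zero, hM, zero_add, mul_one, Finset.sum_range_one, mul_zero,
      pow_zero, add_zero, Int.toNat_natCast, ha]

/-- Column `1` of `θ^2` is interior because `ℓ ^ 2 ≥ 4`, whereas `θ` itself has no interior column
when `ℓ = 2`. Positions inside the image of an interior letter remain interior. -/
theorem exists_mem_X_of_return (θ : ConstLengthSubst A ℓ) (hℓ : 2 ≤ ℓ) {a : A} {k i : ℕ}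
    (hi : i < ℓ ^ k) (ha : θ.powCol k i (θ.powCol 2 1 a) = a) : ∃ x ∈ θ.X, x 0 = a := by
  refine θ.exists_mem_X_of_interior hℓ (p := 2 + k) (m := 1 * ℓ ^ k + i) ?_ ?_
    ((θ.powCol_add _ _ _ _ hi a).trans ha)
  · have : 0 < ℓ ^ k := by positivity
    omega
  · have h1 : 0 < ℓ ^ k := by positivity
    have h2 : 4 ≤ ℓ ^ 2 := by nlinarith
    rw [pow_add]
    nlinarith

theorem IsPrimitive.exists_powCol_eq {θ : ConstLengthSubst A ℓ} (h : θ.IsPrimitive) :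
    ∃ k, ∀ a b : A, ∃ i < ℓ ^ k, θ.powCol k i a = b := by
  obtain ⟨k, hk⟩ := h
  refine ⟨k, fun a b => ?_⟩
  have := hk a b
  rw [iterate_word_singleton, List.mem_ofFn] at this
  obtain ⟨i, hi⟩ := this
  exact ⟨i, i.2, hi⟩

theorem IsPrimitive.exists_mem_X {θ : ConstLengthSubst A ℓ} (h : θ.IsPrimitive) (hℓ : 2 ≤ ℓ)
    (a : A) : ∃ x ∈ θ.X, x 0 = a := by
  obtain ⟨k, hk⟩ := h.exists_powCol_eq
  obtain ⟨i, hi, hia⟩ := hk (θ.powCol 2 1 a) a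
  exact θ.exists_mem_X_of_return hℓ hi hia

theorem IsBijective.powCol_injective {η : ConstLengthSubst B ℓ} (h : η.IsBijective) (n m : ℕ) :
    Function.Injective (η.powCol n m) := by
  induction n generalizing m with
  | zero => exact Function.injective_id
  | succ n ih => exact (h _).1.comp (ih _)

theorem exists_powCol_eq_iterate (θ : ConstLengthSubst A ℓ) {p m : ℕ} (hm : m < ℓ ^ p) (n : ℕ) :
    ∃ k, ∃ i < ℓ ^ k, ∀ a, θ.powCol k i a = (θ.powCol p m)^[n] a := by
  induction n with
  | zero => exact ⟨0, 0, by simp, fun a => rfl⟩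
  | succ n ih =>
    obtain ⟨k, i, hi, h⟩ := ih
    exact ⟨p + k, m * ℓ ^ k + i, index_lt hm hi, fun a => by
      rw [powCol_add _ _ _ _ _ hi, h, Function.iterate_succ_apply]⟩

/-- Replaces primitivity, which is not assumed of `η`: an injective column of a finite alphabet
returns each letter to itself after finitely many iterations. -/
theorem IsBijective.exists_mem_X [Finite B] {η : ConstLengthSubst B ℓ} (h : η.IsBijective)
    (hℓ : 2 ≤ ℓ) (b : B) : ∃ x ∈ η.X, x 0 = b := by
  obtain ⟨n, hn, hb⟩ :=
    Function.mem_periodicPts.1 ((h.powCol_injective 2 1).mem_periodicPts b)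
  obtain ⟨n, rfl⟩ := Nat.exists_eq_succ_of_ne_zero hn.ne'
  obtain ⟨k, i, hi, hki⟩ := η.exists_powCol_eq_iterate (p := 2) (m := 1) (by nlinarith) n
  refine η.exists_mem_X_of_return hℓ hi ?_
  rw [hki, ← Function.iterate_succ_apply]
  exact hb

/-- The subshift contains a point that is periodic under the substitution. -/
theorem exists_mem_periodicPts_seq [Finite A] (θ : ConstLengthSubst A ℓ) (hℓ : 2 ≤ ℓ)
    (hX : θ.X.Nonempty) : ∃ x ∈ θ.X, x ∈ Function.periodicPts θ.seq := by
  obtain ⟨z, hz⟩ := hX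
  -- Near the origin, iterates are determined by the seed at positions `-1` and `0`. Once the seed
  -- repeats with period `q`, the iterates of `θ^q` stabilise on growing windows, and their limit is
  -- fixed by `θ^q`.
  obtain ⟨n₁, n₂, hlt, he⟩ : ∃ n₁ n₂, n₁ < n₂ ∧
      (fun n => (θ.seq^[n] z (-1), θ.seq^[n] z 0)) n₁
        = (fun n => (θ.seq^[n] z (-1), θ.seq^[n] z 0)) n₂ := by
    obtain ⟨n₁, n₂, hne, he⟩ := Finite.exists_ne_map_eq_of_infinite
      (fun n : ℕ => (θ.seq^[n] z (-1), θ.seq^[n] z 0))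
    rcases hne.lt_or_gt with h | h
    exacts [⟨_, _, h, he⟩, ⟨_, _, h, he.symm⟩]
  obtain ⟨p, rfl⟩ := Nat.exists_eq_add_of_lt hlt
  set q := p + 1 with hq
  set w := θ.seq^[n₁] z with hw
  have hwX : w ∈ θ.X := θ.seq_iterate_mem_X hz _
  simp only [Prod.mk.injEq, add_assoc, ← hq] at he
  rw [add_comm n₁ q, Function.iterate_add_apply _ q, ← hw] at he
  obtain ⟨he1, he0⟩ := he
  have hbig : ∀ k : ℕ, (k : ℤ) < (ℓ : ℤ) ^ (q * k) := fun k => by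
    exact_mod_cast (Nat.le_mul_of_pos_left k (Nat.succ_pos p)).trans_lt (Nat.lt_pow_self hℓ)
  have hstep : ∀ (k : ℕ) (i : ℤ), i.natAbs ≤ k →
      θ.seq^[q * (k + 1)] w i = θ.seq^[q * k] w i := by
    intro k i hi
    have hb := hbig k
    rw [mul_add, mul_one, Function.iterate_add_apply, seq_iterate_apply' _ _ (q * k),
      seq_iterate_apply' _ w (q * k)]
    congr 1
    rcases lt_or_ge i 0 with h | h
    · have : i / (ℓ : ℤ) ^ (q * k) = -1 := by
        apply Int.ediv_eq_neg_one_of_neg_of_le <;> omega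
      rw [this, he1]
    · rw [Int.ediv_eq_zero_of_lt h (by omega), he0]
  have hstab : ∀ (k d : ℕ) (i : ℤ), i.natAbs ≤ k →
      θ.seq^[q * (k + d)] w i = θ.seq^[q * k] w i := by
    intro k d i hi
    induction d with
    | zero => rfl
    | succ d ih => rw [← ih, ← add_assoc, hstep _ _ (by omega)]
  have hstab' : ∀ (k : ℕ) (i : ℤ), i.natAbs ≤ k →
      θ.seq^[q * i.natAbs] w i = θ.seq^[q * k] w i := by
    intro k i hi
    obtain ⟨d, rfl⟩ := Nat.exists_eq_add_of_le hi
    rw [hstab _ d i le_rfl]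
  refine ⟨fun i => θ.seq^[q * i.natAbs] w i, θ.mem_X_of_windows fun N =>
    ⟨θ.seq^[q * N] w, θ.seq_iterate_mem_X hwX _, fun i hi => hstab' N i hi⟩,
    Function.mem_periodicPts.2 ⟨q, Nat.succ_pos p, funext fun i => ?_⟩⟩
  have hle : (i / (ℓ : ℤ) ^ q).natAbs ≤ i.natAbs := by
    rw [← Int.natCast_pow]
    exact Int.natAbs_ediv_le_natAbs _ _
  rw [seq_iterate_apply', hstab' _ _ hle, ← seq_iterate_apply', ← Function.iterate_add_apply,
    add_comm q, ← mul_add_one, hstep _ _ le_rfl]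

theorem IsPrimitive.exists_apply_eq {θ : ConstLengthSubst A ℓ} (h : θ.IsPrimitive) {x : ℤ → A}
    (hx : Function.IsFixedPt θ.seq x) (a : A) : ∃ n, x n = a := by
  obtain ⟨k, hk⟩ := h.exists_powCol_eq
  obtain ⟨i, hi, hia⟩ := hk (x 0) a
  exact ⟨_, (isFixedPt_apply hx k i hi 0).trans hia⟩

/-- Every window of a point of the subshift occurs in every fixed point. -/
theorem IsPrimitive.exists_window {θ : ConstLengthSubst A ℓ} (h : θ.IsPrimitive) {x z : ℤ → A}
    (hx : Function.IsFixedPt θ.seq x) (hz : z ∈ θ.X) (n : ℤ) (r : ℕ) :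
    ∃ n' : ℤ, ∀ i : ℤ, i.natAbs ≤ r → z (n + i) = x (n' + i) := by
  obtain ⟨a, k, i, hi, hw⟩ := θ.mem_X_iff.1 hz (n - r) (2 * r + 1)
  obtain ⟨t, rfl⟩ := h.exists_apply_eq hx a
  -- The block grown from `x t` contains the window from offset `i`; its centre is `r` further on.
  refine ⟨t * (ℓ : ℤ) ^ k + i + r, fun j hj => ?_⟩
  have h1 := hw (j + r).toNat (by omega)
  rw [← isFixedPt_apply hx _ _ (by omega)] at h1
  convert h1 using 2 <;> omega

end Columns

end ConstLengthSubst

namespace ConstLengthSubst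

variable {A B : Type*} {ℓ : ℕ}

/-! ### The column semigroup and its minimal rank. -/

section Semigroup

variable [NeZero ℓ]

theorem powCol_mem_semigroup (θ : ConstLengthSubst A ℓ) (n m : ℕ) :
    (θ.powCol (n + 1) m : Function.End A) ∈ θ.semigroup := by
  induction n generalizing m with
  | zero => exact Subsemigroup.subset_closure ⟨_, rfl⟩
  | succ n ih => exact θ.semigroup.mul_mem (Subsemigroup.subset_closure ⟨_, rfl⟩) (ih _)

theorem exists_powCol_eq_of_mem_semigroup (θ : ConstLengthSubst A ℓ) {f : Function.End A}
    (hf : f ∈ θ.semigroup) : ∃ n, ∃ m < ℓ ^ n, f = θ.powCol n m := by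
  induction hf using Subsemigroup.closure_induction with
  | mem f hf =>
    obtain ⟨m, rfl⟩ := hf
    exact ⟨1, m, by simp, (θ.powCol_one m).symm⟩
  | mul f g _ _ hf hg =>
    obtain ⟨k, i, hi, rfl⟩ := hf
    obtain ⟨n, m, hm, rfl⟩ := hg
    exact ⟨n + k, m * ℓ ^ k + i, index_lt hm hi, funext fun a => (θ.powCol_add n k m i hi a).symm⟩

theorem columnNumber_le (θ : ConstLengthSubst A ℓ) {n m : ℕ} (hm : m < ℓ ^ n) :
    θ.columnNumber ≤ (Set.range (θ.powCol n m)).ncard :=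
  Nat.sInf_le ⟨n, m, hm, rfl⟩

theorem columnNumber_le_of_mem_semigroup (θ : ConstLengthSubst A ℓ) {f : Function.End A}
    (hf : f ∈ θ.semigroup) : θ.columnNumber ≤ (Set.range (f : A → A)).ncard := by
  obtain ⟨n, m, hm, rfl⟩ := θ.exists_powCol_eq_of_mem_semigroup hf
  exact θ.columnNumber_le hm

theorem exists_mem_semigroup_ncard_range_eq [Finite A] (θ : ConstLengthSubst A ℓ) :
    ∃ f ∈ θ.semigroup, (Set.range (f : A → A)).ncard = θ.columnNumber := by
  obtain ⟨n, m, hm, hc⟩ :=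
    Nat.sInf_mem (s := {r : ℕ | ∃ n m : ℕ, m < ℓ ^ n ∧ r = (Set.range (θ.powCol n m)).ncard})
      ⟨_, 0, 0, by simp, rfl⟩
  -- The minimum may be attained at `n = 0`, by the identity, which need not lie in the semigroup.
  -- Composing with one more column fixes this without raising the rank.
  refine ⟨_, θ.powCol_mem_semigroup n (m * ℓ ^ 1 + 0), le_antisymm ?_
    (θ.columnNumber_le (index_lt hm (by simpa using NeZero.pos ℓ)))⟩
  have e : θ.powCol (n + 1) (m * ℓ ^ 1 + 0) = θ.powCol 1 0 ∘ θ.powCol n m :=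
    funext (θ.powCol_add n 1 m 0 (by simpa using NeZero.pos ℓ))
  refine le_trans ?_ hc.ge
  rw [e, Set.range_comp]
  exact Set.ncard_image_le (Set.toFinite _)

theorem comp_powCol_of_comp_col {θ : ConstLengthSubst A ℓ} {η : ConstLengthSubst B ℓ} {β : A → B}
    (h : ∀ m a, β (θ.col m a) = η.col m (β a)) (n m : ℕ) (a : A) :
    β (θ.powCol n m a) = η.powCol n m (β a) := by
  induction n generalizing m with
  | zero => rfl
  | succ n ih => simp only [powCol, Function.comp_apply, h, ih]

end Semigroup

/-! ### Local rules and letter codes. -/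

section FactorMap

theorem isClosed_X [Finite A] [TopologicalSpace A] [DiscreteTopology A]
    (θ : ConstLengthSubst A ℓ) : IsClosed θ.X := by
  have e : θ.X = ⋂ (i : ℤ) (n : ℕ), (fun (x : ℤ → A) (j : Fin n) => x (i + (j : ℕ))) ⁻¹'
      {w | θ.Allowed (List.ofFn w)} := by
    ext x
    simp [X]
  rw [e]
  exact isClosed_iInter fun i => isClosed_iInter fun n =>
    (isClosed_discrete _).preimage (by fun_prop)

theorem compactSpace_X [Finite A] [TopologicalSpace A] [DiscreteTopology A]
    (θ : ConstLengthSubst A ℓ) : CompactSpace θ.X :=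
  isCompact_iff_compactSpace.1 θ.isClosed_X.isCompact

/-- The translation of `X_θ` by an integer. -/
def translateX [NeZero ℓ] (θ : ConstLengthSubst A ℓ) (t : ℤ) (x : θ.X) : θ.X :=
  ⟨fun i => (x : ℤ → A) (i + t), θ.translate_mem_X x.2 t⟩

theorem apply_translateX [NeZero ℓ] {θ : ConstLengthSubst A ℓ} {η : ConstLengthSubst B ℓ}
    {F : θ.X → η.X} (hF : Function.Semiconj F θ.shiftX η.shiftX) (t : ℤ) (x : θ.X) (n : ℤ) :
    (F (θ.translateX t x) : ℤ → B) n = (F x : ℤ → B) (n + t) := by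
  have hnat : ∀ (k : ℕ) (x : θ.X) (n : ℤ),
      (F (θ.translateX k x) : ℤ → B) n = (F x : ℤ → B) (n + k) := by
    intro k
    induction k with
    | zero =>
      intro x n
      have : θ.translateX (0 : ℕ) x = x := by
        apply Subtype.ext; funext i; simp [translateX]
      rw [this, Nat.cast_zero, add_zero]
    | succ k ih =>
      intro x n
      have : θ.translateX (k + 1 : ℕ) x = θ.shiftX (θ.translateX k x) := by
        apply Subtype.ext; funext i
        exact congrArg (x : ℤ → A) (by push_cast; ring)
      rw [this, hF]
      change (F (θ.translateX k x) : ℤ → B) (n + 1) = _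
      rw [ih]
      exact congrArg (F x : ℤ → B) (by push_cast; ring)
  rcases Int.eq_nat_or_neg t with ⟨k, rfl | rfl⟩
  · exact hnat k x n
  · have h := hnat k (θ.translateX (-k) x) (n - k)
    have : θ.translateX k (θ.translateX (-k) x) = x := by
      apply Subtype.ext; funext i; simp [translateX]
    rw [this, sub_add_cancel] at h
    rw [← h, sub_eq_add_neg]

/-- A continuous shift-commuting map is given by a local rule on a finite window. -/
theorem IsFactorMap.exists_radius [NeZero ℓ] [Finite A] {θ : ConstLengthSubst A ℓ}
    {η : ConstLengthSubst B ℓ} {F : θ.X → η.X} (hF : θ.IsFactorMap η F) :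
    ∃ r : ℕ, ∀ (z z' : θ.X) (n n' : ℤ),
      (∀ i : ℤ, i.natAbs ≤ r → (z : ℤ → A) (n + i) = (z' : ℤ → A) (n' + i)) →
        (F z : ℤ → B) n = (F z' : ℤ → B) n' := by
  let : TopologicalSpace A := ⊥
  let : TopologicalSpace B := ⊥
  have : DiscreteTopology A := ⟨rfl⟩
  have : DiscreteTopology B := ⟨rfl⟩
  have : CompactSpace θ.X := θ.compactSpace_X
  obtain ⟨hcont, -, hsemi⟩ := hF
  replace hcont : Continuous F := hcont
  have hcoord : ∀ i : ℤ, Continuous fun z : θ.X => (z : ℤ → A) i := fun i =>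
    (continuous_apply i).comp continuous_subtype_val
  have hcont0 : Continuous fun z : θ.X => (F z : ℤ → B) 0 :=
    (continuous_apply 0).comp (continuous_subtype_val.comp hcont)
  obtain ⟨r, hr⟩ : ∃ r : ℕ, ∀ z z' : θ.X,
      (∀ i : ℤ, i.natAbs ≤ r → (z : ℤ → A) i = (z' : ℤ → A) i) →
        (F z : ℤ → B) 0 = (F z' : ℤ → B) 0 := by
    by_contra! hcon
    -- If no radius works, these nested closed sets are nonempty, and compactness gives a point with
    -- two different images.
    set T : ℕ → Set (θ.X × θ.X) := fun r =>
      {p | (∀ i : ℤ, i.natAbs ≤ r → (p.1 : ℤ → A) i = (p.2 : ℤ → A) i) ∧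
        (F p.1 : ℤ → B) 0 ≠ (F p.2 : ℤ → B) 0} with hT
    have hclosed : ∀ r, IsClosed (T r) := by
      intro r
      have h1 : IsClosed {p : θ.X × θ.X | ∀ i : ℤ, i.natAbs ≤ r →
          (p.1 : ℤ → A) i = (p.2 : ℤ → A) i} := by
        simp only [Set.ofPred_forall]
        exact isClosed_iInter fun i => isClosed_iInter fun _ =>
          isClosed_eq ((hcoord i).comp continuous_fst) ((hcoord i).comp continuous_snd)
      have h2 : IsClosed {p : θ.X × θ.X | (F p.1 : ℤ → B) 0 ≠ (F p.2 : ℤ → B) 0} :=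
        (isClosed_discrete {q : B × B | q.1 ≠ q.2}).preimage
          ((hcont0.comp continuous_fst).prodMk (hcont0.comp continuous_snd))
      exact h1.inter h2
    obtain ⟨p, hp⟩ := IsCompact.nonempty_iInter_of_sequence_nonempty_isCompact_isClosed T
      (fun r p hp => ⟨fun i hi => hp.1 i (by omega), hp.2⟩)
      (fun r => by
        obtain ⟨z, z', h, hne⟩ := hcon r
        exact ⟨(z, z'), h, hne⟩)
      (hclosed 0).isCompact hclosed
    rw [Set.mem_iInter] at hp
    refine (hp 0).2 ?_
    rw [show p.1 = p.2 from Subtype.ext (funext fun i => (hp i.natAbs).1 i le_rfl)]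
  refine ⟨r, fun z z' n n' h => ?_⟩
  have := hr (θ.translateX n z) (θ.translateX n' z') fun i hi => by
    simpa only [translateX, add_comm i] using h i hi
  simpa only [apply_translateX hsemi, zero_add] using this

/-- A letter-to-letter code intertwining the columns of a primitive substitution with those of
another one induces a factor map. -/
theorem IsPrimitive.exists_factorMap [NeZero ℓ] [Finite A] {θ : ConstLengthSubst A ℓ}
    (h : θ.IsPrimitive) (hℓ : 2 ≤ ℓ) {η : ConstLengthSubst B ℓ} {β : A → B}
    (hβ : Function.Surjective β) (hcol : ∀ m a, β (θ.col m a) = η.col m (β a)) :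
    ∃ F : θ.X → η.X, θ.IsFactorMap η F ∧ θ.PreservesFixedPointFibre η F := by
  have hmem : ∀ x : θ.X, (fun n => β ((x : ℤ → A) n)) ∈ η.X := fun x => by
    refine η.mem_X_iff.2 fun s n => ?_
    obtain ⟨a, k, i, hi, hw⟩ := θ.mem_X_iff.1 x.2 s n
    exact ⟨β a, k, i, hi, fun j hj => by rw [hw j hj, comp_powCol_of_comp_col hcol]⟩
  refine ⟨fun x => ⟨_, hmem x⟩, ⟨?_, fun y => ?_, fun x => rfl⟩, fun x hx => funext fun n => ?_⟩
  · let : TopologicalSpace A := ⊥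
    let : TopologicalSpace B := ⊥
    have : DiscreteTopology A := ⟨rfl⟩
    refine Continuous.subtype_mk (continuous_pi fun n => ?_) _
    exact continuous_of_discreteTopology.comp ((continuous_apply n).comp continuous_subtype_val)
  · let : TopologicalSpace A := ⊥
    let : TopologicalSpace B := ⊥
    have : DiscreteTopology A := ⟨rfl⟩
    have : DiscreteTopology B := ⟨rfl⟩
    have : CompactSpace θ.X := θ.compactSpace_X
    have hcont : ∀ i : ℤ, Continuous fun z : θ.X => β ((z : ℤ → A) i) := fun i =>
      continuous_of_discreteTopology.comp ((continuous_apply i).comp continuous_subtype_val)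
    have hclosed : ∀ r : ℕ, IsClosed {z : θ.X | ∀ i : ℤ, i.natAbs ≤ r →
        β ((z : ℤ → A) i) = (y : ℤ → B) i} := fun r => by
      simp only [Set.ofPred_forall]
      exact isClosed_iInter fun i => isClosed_iInter fun _ =>
        isClosed_eq (hcont i) continuous_const
    obtain ⟨z, hz⟩ := IsCompact.nonempty_iInter_of_sequence_nonempty_isCompact_isClosed
      (fun r : ℕ => {z : θ.X | ∀ i : ℤ, i.natAbs ≤ r → β ((z : ℤ → A) i) = (y : ℤ → B) i})
      (fun r z hz i hi => hz i (by omega))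
      (fun r => by
        obtain ⟨b, k, j, hj, hw⟩ := η.mem_X_iff.1 y.2 (-r) (2 * r + 1)
        obtain ⟨a, rfl⟩ := hβ b
        obtain ⟨x, hx, rfl⟩ := h.exists_mem_X hℓ a
        -- The window of `y` sits in `η^k (β a)`; realise `a` at the origin, apply `θ^k`, and
        -- recentre. Compactness then yields an exact preimage.
        refine ⟨θ.translateX (j + r) ⟨_, θ.seq_iterate_mem_X hx k⟩, fun i hi => ?_⟩
        have h1 := hw (i + r).toNat (by omega)
        rw [← comp_powCol_of_comp_col hcol, ← θ.seq_iterate_apply x k _ (by omega)] at h1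
        have e1 : (0 : ℤ) * (ℓ : ℤ) ^ k + (j + (i + r).toNat : ℕ) = i + (j + r) := by omega
        have e2 : -(r : ℤ) + ((i + r).toNat : ℕ) = i := by omega
        rw [e1, e2] at h1
        exact h1.symm)
      (hclosed 0).isCompact hclosed
    rw [Set.mem_iInter] at hz
    exact ⟨z, Subtype.ext (funext fun i => hz i.natAbs i le_rfl)⟩
  · change η.seq _ n = β ((x : ℤ → A) n)
    conv_rhs => rw [← hx.eq]
    simp only [seq, hcol]

theorem IsPrimitive.hasRadiusZero [NeZero ℓ] [Finite A] [Finite B] {θ : ConstLengthSubst A ℓ}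
    (h : θ.IsPrimitive) (hℓ : 2 ≤ ℓ) {η : ConstLengthSubst B ℓ} (hη : η.IsBijective)
    {F : θ.X → η.X} (hF : θ.IsFactorMap η F) {x : θ.X}
    (hx : Function.IsFixedPt θ.seq (x : ℤ → A)) (hFx : Function.IsFixedPt η.seq (F x : ℤ → B)) :
    θ.HasRadiusZero η F := by
  obtain ⟨r, hr⟩ := hF.exists_radius
  have hwell : ∀ n n' : ℤ, (x : ℤ → A) n = (x : ℤ → A) n' →
      (F x : ℤ → B) n = (F x : ℤ → B) n' := by
    intro n n' hn
    -- A block of length `ℓ ^ (2 * r)` contains the whole radius-`r` window around its position `r`.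
    have hk : 2 * r < ℓ ^ (2 * r) := Nat.lt_pow_self hℓ
    apply hη.powCol_injective (2 * r) r
    rw [← isFixedPt_apply hFx _ _ (by omega), ← isFixedPt_apply hFx _ _ (by omega)]
    refine hr _ _ _ _ fun i hi => ?_
    have e : ∀ t : ℤ, t * (ℓ : ℤ) ^ (2 * r) + r + i = t * (ℓ : ℤ) ^ (2 * r) + (r + i).toNat :=
      fun t => by omega
    rw [e, e, isFixedPt_apply hx _ _ (by omega), isFixedPt_apply hx _ _ (by omega), hn]
  choose pos hpos using h.exists_apply_eq hx
  have hβ : ∀ (z : θ.X) (n : ℤ), (F z : ℤ → B) n = (F x : ℤ → B) (pos ((z : ℤ → A) n)) := by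
    intro z n
    obtain ⟨n', hn'⟩ := h.exists_window hx z.2 n r
    rw [hr z x n n' hn']
    apply hwell
    have := hn' 0 (by simp)
    rw [add_zero, add_zero] at this
    rw [hpos, this]
  refine ⟨fun a => (F x : ℤ → B) (pos a), fun b => ?_, hβ⟩
  obtain ⟨y, hy, rfl⟩ := hη.exists_mem_X hℓ b
  obtain ⟨z, hz⟩ := hF.2.1 ⟨y, hy⟩
  refine ⟨(z : ℤ → A) 0, ?_⟩
  simp only [← hβ, hz]

end FactorMap

end ConstLengthSubst

/-! ### The equivalence and the radius-zero statement. -/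

theorem mainTheorem5 {A : Type u} [Finite A] [Nonempty A] {ℓ : ℕ} [NeZero ℓ] (hℓ : 2 ≤ ℓ)
    (θ : ConstLengthSubst A ℓ) (hprim : θ.IsPrimitive) (haper : θ.IsAperiodic)
    (hfix : ∀ x ∈ θ.X, x ∈ Function.periodicPts θ.seq → Function.IsFixedPt θ.seq x)
    (c : ℕ) (hc : θ.columnNumber = c) :
    ((∃ (B : Type u) (_ : Finite B) (η : ConstLengthSubst B ℓ) (F : θ.X → η.X),
        Nat.card B = c ∧ η.IsBijective ∧ θ.IsFactorMap η F ∧ θ.PreservesFixedPointFibre η F) ↔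
      HasUniqueMinimalLeftIdeal θ.semigroup) ∧
    (∀ (B : Type v) [Finite B] (η : ConstLengthSubst B ℓ) (F : θ.X → η.X),
      η.IsBijective → θ.IsFactorMap η F → θ.PreservesFixedPointFibre η F →
        θ.HasRadiusZero η F) := by
  subst hc
  obtain ⟨x, hxX, hx⟩ : ∃ x ∈ θ.X, Function.IsFixedPt θ.seq x := by
    obtain ⟨z, hz, -⟩ := hprim.exists_mem_X hℓ (Classical.arbitrary A)
    obtain ⟨x, hxX, hx⟩ := θ.exists_mem_periodicPts_seq hℓ ⟨z, hz⟩
    exact ⟨x, hxX, hfix x hxX hx⟩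
  rw [hasUniqueMinimalLeftIdeal_iff θ.semigroup
    (fun f hf => θ.columnNumber_le_of_mem_semigroup hf) θ.exists_mem_semigroup_ncard_range_eq]
  refine ⟨⟨?_, fun hker => ?_⟩, fun B _ η F hη hF hFfix =>
    hprim.hasRadiusZero hℓ hη hF (x := ⟨x, hxX⟩) hx (hFfix _ hx)⟩
  · rintro ⟨B, _, η, F, hB, hη, hF, hFfix⟩
    obtain ⟨β, hβ, hFβ⟩ := hprim.hasRadiusZero hℓ hη hF (x := ⟨x, hxX⟩) hx (hFfix _ hx)
    have hcol : ∀ m a, β (θ.col m a) = η.col m (β a) := by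
      intro m a
      obtain ⟨n, rfl⟩ := hprim.exists_apply_eq hx a
      have hm : (m : ℕ) < ℓ ^ 1 := by simp
      rw [← θ.powCol_one, ← η.powCol_one, ← ConstLengthSubst.isFixedPt_apply hx 1 m hm,
        ← hFβ ⟨x, hxX⟩, ← hFβ ⟨x, hxX⟩, ConstLengthSubst.isFixedPt_apply (hFfix _ hx) 1 m hm]
    have hfib : ∀ f ∈ θ.semigroup, (Set.range (f : A → A)).ncard = θ.columnNumber →
        ∀ a b : A, f a = f b ↔ β a = β b := by
      intro f hf hfc a b
      obtain ⟨n, m, hm, rfl⟩ := θ.exists_powCol_eq_of_mem_semigroup hf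
      have hint := ConstLengthSubst.comp_powCol_of_comp_col hcol n m
      have hinj := hη.powCol_injective n m
      -- The columns of `η` permute its `c` letters, so `β` maps the `c`-element image of a
      -- minimal-rank column onto all of them, hence injectively.
      have hsurj : Set.range (β ∘ θ.powCol n m) = Set.univ := by
        rw [show β ∘ θ.powCol n m = η.powCol n m ∘ β from funext hint]
        exact ((Finite.surjective_of_injective hinj).comp hβ).range_eq
      rw [← eq_iff_of_ncard_range_le (f := θ.powCol n m) (g := β)
        (by rw [hsurj, Set.ncard_univ, hB]; exact hfc.le), hint, hint, hinj.eq_iff]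
    intro f hf g hg hfc hgc a b hab
    exact (hfib g hg hgc a b).2 ((hfib f hf hfc a b).1 hab)
  · obtain ⟨f, hf, hfc⟩ := θ.exists_mem_semigroup_ncard_range_eq
    -- `f ∘ θ.col m` again has minimal rank, so it shares the fibres of `f`: each column induces an
    -- injective map on those fibres.
    have hfib : ∀ m a b, f (θ.col m a) = f (θ.col m b) ↔ f a = f b := by
      intro m a b
      have hmem : (f ∘ θ.col m : A → A) ∈ θ.semigroup :=
        θ.semigroup.mul_mem hf (Subsemigroup.subset_closure ⟨m, rfl⟩)
      have hrank : (Set.range (f ∘ θ.col m : A → A)).ncard = θ.columnNumber := by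
        refine le_antisymm (hfc ▸ ?_) (θ.columnNumber_le_of_mem_semigroup hmem)
        exact Set.ncard_le_ncard (Set.range_comp_subset_range (θ.col m) f) (Set.toFinite _)
      exact ⟨hker _ hmem f hf hrank hfc a b, hker f hf _ hmem hfc hrank a b⟩
    set β : A → Set.range (f : A → A) := Set.rangeFactorization f with hβdef
    have hβ : Function.Surjective β := Set.rangeFactorization_surjective
    have hβeq : ∀ a b, β a = β b ↔ f a = f b := fun a b => Subtype.ext_iff
    let η : ConstLengthSubst (Set.range (f : A → A)) ℓ :=
      ⟨fun m b => β (θ.col m (Function.surjInv hβ b))⟩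
    have hcol : ∀ m a, β (θ.col m a) = η.col m (β a) := by
      intro m a
      exact ((hβeq _ _).2 ((hfib m _ a).2 ((hβeq _ _).1 (Function.surjInv_eq hβ (β a))))).symm
    obtain ⟨F, hF, hFfix⟩ := hprim.exists_factorMap hℓ hβ hcol
    refine ⟨Set.range (f : A → A), inferInstance, η, F, hfc, fun m => ?_, hF, hFfix⟩
    apply Function.Injective.bijective_of_finite
    intro b b' hbb
    obtain ⟨a, rfl⟩ := hβ b
    obtain ⟨a', rfl⟩ := hβ b'
    rwa [← hcol, ← hcol, hβeq, hfib, ← hβeq] at hbb
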